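/- Let $\mathcal H$ be the upper half plane, $\mathrm{Hol}$ the algebra of holomorphic functions on $\mathcal H$, and $\mathcal M(k)$ the space of holomorphic modular forms of weight $k$ on $\mathrm{SL}(2,\mathbb Z)$. Let $E_2,E_4,E_6$ be the Eisenstein series normalized to have constant term $1$. For $k\in\mathbb R$ put $D_kf=\frac1{2\pi i}\frac{df}{dz}-\frac{k}{12}E_2f$, $D_k^0=1$ and $D_k^{N}=D_{k+2N-2}\cdots D_{k+2}D_k$. A modular linear differential equation (MLDE) of weight $k$ and order $N$ is an equation $$(g_0D_k^N+g_1D_k^{N-1}+\cdots+g_N)f=0,\qquad g_i\in\mathcal M(l+2i),\quad g_0\ne0,$$ for some integer $l\ge0$; it is monic if $l=0$ and $g_0=1$. Let $H=\bigoplus_{r\in\mathbb R}H_r$ with $H_r=\mathrm{Hol}$, and write $(f,r)$ for $f\in\mathrm{Hol}$ placed in degree $r$. Let $\delta,e_4,e_6$ be the $\mathbb C$-linear endomorphisms of $H$ with $\delta(f,r)=(D_rf,r+2)$, $e_4(f,r)=(E_4f,r+4)$, $e_6(f,r)=(E_6f,r+6)$, and let $\mathcal R$ be the $\mathbb C$-algebra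 generated by $\delta,e_4,e_6$. An element of $\mathcal R$ is called monic of order $N\ge0$ if it has the form $\delta^N+a_{N-1}\delta^{N-1}+\cdots+a_1\delta+a_0$ with every $a_i$ in the subalgebra $\mathbb C[e_4,e_6]$. For $\phi\in H$ the modular order $\mathrm{mord}(\phi)\in\{0,1,2,\dots,\infty\}$ is the least $N\ge 0$ such that some monic element of $\mathcal R$ of order $N$ annihilates $\phi$, and $\infty$ if there is none. The function $E_4^mE_6^n$ is regarded as the element $(E_4^mE_6^n,4m+6n)$ of $H$. **Theorem.** (i) Let $m,n\ge0$ and $N\ge1$ be integers. If $E_4^mE_6^n$ satisfies a monic MLDE of weight $4m+6n$ and order $N$, then $N\ge\max\{m,n\}+1$. (ii) For all integers $m,n\ge0$, $\mathrm{mord}(E_4^mE_6^n)\ge\max\{m,n\}+1$. (iii) For every integer $n\ge0$, $\mathrm{mord}(E_4^n)=\mathrm{mord}(E_6^n)=\mathrm{mord}(E_4^nE_6^n)=n+1$. -/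

import Mathlib

namespace ModularLDE

open UpperHalfPlane
open scoped Manifold MatrixGroups DirectSum

noncomputable section

/-- The algebra of all holomorphic functions on the upper half plane. -/
def Hol : Subalgebra ℂ (ℍ → ℂ) where
  carrier := {f | MDiff f}
  mul_mem' {_ _} hf hg := MDifferentiable.mul hf hg
  add_mem' {_ _} hf hg := MDifferentiable.add hf hg
  algebraMap_mem' _ := mdifferentiable_const

/-- A modular form of level one, as a holomorphic function. -/
def formToHol {k : ℤ} (g : ModularForm 𝒮ℒ k) : Hol :=
  ⟨⇑g, ModularFormClass.holo g⟩

/-- The normalised Eisenstein series of weight `4`. -/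
def E4 : Hol := formToHol ModularForm.E₄

/-- The normalised Eisenstein series of weight `6`. -/
def E6 : Hol := formToHol ModularForm.E₆

/-- The Ramanujan-Serre operator `D_k f = (2πi)⁻¹ f' - (k / 12) E₂ f`. -/
def serreD (k : ℝ) : Hol →ₗ[ℂ] Hol where
  toFun f := ⟨Derivative.serreDerivative (k : ℂ) f.1,
    Derivative.serreDerivative_mdifferentiable _ f.2⟩
  map_add' f g := Subtype.ext (Derivative.serreDerivative_add _ f.1 g.1 f.2 g.2)
  map_smul' c f := Subtype.ext (Derivative.serreDerivative_smul _ c f.1 f.2)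

/-- The iterated operator `D_{k+2n-2} ∘ ⋯ ∘ D_{k+2} ∘ D_k` (`n` factors). -/
def serreIter (k : ℝ) : ℕ → (Hol →ₗ[ℂ] Hol)
  | 0 => LinearMap.id
  | n + 1 => serreD (k + 2 * n) ∘ₗ serreIter k n

/-- A modular linear differential equation
`g₀ D_k^N f + g₁ D_k^(N-1) f + ⋯ + g_N f = 0` of weight `k` and order `N`: the coefficient `g_i` is
a modular form of level one and weight `l + 2i` for some `l ≥ 0`, and `g₀ ≠ 0`. -/
structure MLDE (k : ℝ) (N : ℕ) where
  /-- The weight of the leading coefficient. -/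
  l : ℕ
  /-- The coefficients `g_0, ..., g_N`. -/
  coeff : (i : Fin (N + 1)) → ModularForm 𝒮ℒ ((l : ℤ) + 2 * (i : ℕ))
  /-- The leading coefficient is not zero. -/
  coeff_zero_ne_zero : coeff 0 ≠ 0

/-- The equation is monic: `l = 0` and `g₀ = 1`. -/
def MLDE.IsMonic {k : ℝ} {N : ℕ} (e : MLDE k N) : Prop :=
  e.l = 0 ∧ ∀ z : ℍ, e.coeff 0 z = 1

/-- The holomorphic function `f` is a solution. -/
def MLDE.IsSolution {k : ℝ} {N : ℕ} (e : MLDE k N) (f : Hol) : Prop :=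
  ∑ i : Fin (N + 1), formToHol (e.coeff i) * serreIter k (N - (i : ℕ)) f = 0

/-- The space `H = ⨁_{r ∈ ℝ} H_r`, where every `H_r` is the space of holomorphic functions. -/
abbrev H : Type := ⨁ _ : ℝ, Hol

/-- The element `(f, r)` of `H`: the function `f` placed in weight `r`. -/
def inWeight (r : ℝ) : Hol →ₗ[ℂ] H := DirectSum.lof ℂ ℝ (fun _ => Hol) r

/-- The endomorphism `(f, r) ↦ (D_r f, r + 2)` of `H`. -/
def delta : Module.End ℂ H :=
  DirectSum.toModule ℂ ℝ H fun r => inWeight (r + 2) ∘ₗ serreD r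

/-- The endomorphism `(f, r) ↦ (E₄ f, r + 4)` of `H`. -/
def e4 : Module.End ℂ H :=
  DirectSum.toModule ℂ ℝ H fun r => inWeight (r + 4) ∘ₗ LinearMap.mulLeft ℂ E4

/-- The endomorphism `(f, r) ↦ (E₆ f, r + 6)` of `H`. -/
def e6 : Module.End ℂ H :=
  DirectSum.toModule ℂ ℝ H fun r => inWeight (r + 6) ∘ₗ LinearMap.mulLeft ℂ E6

/-- The algebra of modular linear differential operators, generated by `δ`, `e₄` and `e₆`. -/
def MLDO : Subalgebra ℂ (Module.End ℂ H) := Algebra.adjoin ℂ {delta, e4, e6}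

/-- The subalgebra generated by `e₄` and `e₆`, a copy of the ring of modular forms. -/
def MLDOCoeff : Subalgebra ℂ (Module.End ℂ H) := Algebra.adjoin ℂ {e4, e6}

/-- The monic modular linear differential operators of order `N`, that is, those of the form
`δ^N + a_{N-1} δ^{N-1} + ⋯ + a_1 δ + a_0` with modular coefficients (of arbitrary,
possibly mixed weights). -/
def monicMLDO (N : ℕ) : Set (Module.End ℂ H) :=
  {a | a ∈ MLDO ∧ ∃ c : Fin N → MLDOCoeff,
    a = delta ^ N + ∑ i : Fin N, (c i : Module.End ℂ H) * delta ^ (i : ℕ)}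

/-- The modular order of `φ`: the least `N` such that some monic operator of order `N`
annihilates `φ`, and `∞` if there is none. -/
def mord (φ : H) : ℕ∞ :=
  sInf {x : ℕ∞ | ∃ N : ℕ, x = N ∧ ∃ a ∈ monicMLDO N, a φ = 0}

end

end ModularLDE

namespace ModularLDE

open UpperHalfPlane
open scoped Manifold MatrixGroups DirectSum

noncomputable section

open Filter Topology ModularForm Function.Periodic Derivative

/-! Lower bound: `E4` and `E6` have simple zeros, since `D E4 = -E6/3`, `D E6 = -E4²/2` and they
have no common zero. At such a zero each Serre derivative lowers the order of vanishing of `E4 ^ m *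
E6 ^ n` by exactly one (`serreIter_pow_mul`), so if `N ≤ m` or `N ≤ n` the leading term of a monic
equation vanishes to strictly lower order than all others. Only holomorphy of the coefficients
matters, so this also bounds `mord`.

Upper bound: `y = E4`, `E6`, `E4 * E6` each satisfy `D²y = c E4 y`, and the `n`-th symmetric power
of this equation is monic of order `n + 1` and kills `y ^ n` (`exists_symmetricPower`). -/

/-! ### Limits at the cusp. -/

lemma tendsto_cuspFunction_zero {f : ℍ → ℂ} (hper : Function.Periodic (f ∘ ofComplex) 1)
    (hf : MDiff f) (hb : IsBoundedAtImInfty f) :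
    Tendsto f atImInfty (𝓝 (cuspFunction 1 f 0)) := by
  have hfun : (cuspFunction 1 f ∘ fun τ : ℍ ↦ qParam 1 τ) = f := by
    funext τ
    simpa using eq_cuspFunction (h := 1) τ one_ne_zero (by simpa using hper)
  have han : AnalyticAt ℂ (cuspFunction 1 f) 0 :=
    analyticAt_cuspFunction_zero one_pos (by simpa using hper) hf hb
  simpa [hfun] using han.continuousAt.tendsto.comp (qParam_tendsto_atImInfty one_pos)

/-- With `f = F(q)`, the normalised derivative is `q F'(q)`, and `q → 0`. -/
lemma normalizedDeriv_tendsto_zero {f : ℍ → ℂ} (hper : Function.Periodic (f ∘ ofComplex) 1)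
    (hf : MDiff f) (hb : IsBoundedAtImInfty f) :
    Tendsto (normalizedDerivOfComplex f) atImInfty (𝓝 0) := by
  have hper' : Function.Periodic (f ∘ ofComplex) (1 : ℝ) := by simpa using hper
  have han : AnalyticAt ℂ (cuspFunction 1 f) 0 :=
    analyticAt_cuspFunction_zero one_pos hper' hf hb
  have hD : normalizedDerivOfComplex f =
      fun τ : ℍ ↦ deriv (cuspFunction 1 f) (qParam 1 τ) * qParam 1 τ := by
    funext τ
    have hc : f ∘ ofComplex = cuspFunction 1 f ∘ qParam 1 := by
      funext z
      exact (Function.Periodic.eq_cuspFunction one_ne_zero hper' z).symm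
    have hq : HasDerivAt (qParam 1) (2 * Real.pi * Complex.I * qParam 1 τ) (τ : ℂ) := by
      have h : HasDerivAt (fun z : ℂ ↦ 2 * Real.pi * Complex.I * z / (1 : ℝ))
          (2 * Real.pi * Complex.I) (τ : ℂ) := by
        simpa using (hasDerivAt_id (τ : ℂ)).const_mul (2 * Real.pi * Complex.I)
      have hfun : qParam 1 = fun z : ℂ ↦ Complex.exp (2 * Real.pi * Complex.I * z / (1 : ℝ)) := rfl
      rw [hfun]
      simpa only [mul_comm] using h.cexp
    have hd := (differentiableAt_cuspFunction one_pos hper' hf hb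
      (norm_qParam_lt_one one_pos τ.im_pos)).hasDerivAt.comp (τ : ℂ) hq
    rw [normalizedDerivOfComplex, hc, hd.deriv]
    have := Complex.two_pi_I_ne_zero
    field_simp
  rw [hD]
  simpa using (han.deriv.continuousAt.tendsto.comp (qParam_tendsto_atImInfty one_pos)).mul
    (qParam_tendsto_atImInfty one_pos)

lemma periodic_E2 : Function.Periodic (EisensteinSeries.E2 ∘ ofComplex) 1 := by
  intro w
  by_cases hw : 0 < w.im
  · have hw' : 0 < (w + 1).im := by simpa using hw
    simp only [Function.comp_apply, ofComplex_apply_of_im_pos hw, ofComplex_apply_of_im_pos hw',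
      EisensteinSeries.E2_eq_tsum_cexp]
    have h : Complex.exp (2 * Real.pi * Complex.I * (w + 1)) =
        Complex.exp (2 * Real.pi * Complex.I * w) := by
      rw [mul_add, mul_one, Complex.exp_add, Complex.exp_two_pi_mul_I, mul_one]
    rw [h]
  -- Off the half plane `ofComplex` takes one constant default value.
  · have hw' : ¬ 0 < (w + 1).im := by simpa using hw
    simp only [Function.comp_apply, ofComplex_apply_of_im_nonpos (not_lt.mp hw),
      ofComplex_apply_of_im_nonpos (not_lt.mp hw')]

lemma analyticAt_cuspFunction_E2 : AnalyticAt ℂ (cuspFunction 1 EisensteinSeries.E2) 0 :=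
  analyticAt_cuspFunction_zero one_pos (by simpa using periodic_E2)
    E2_mdifferentiable EisensteinSeries.isBoundedAtImInfty_E2

lemma hasSum_E2 (τ : ℍ) : HasSum (fun m : ℕ ↦ (if m = 0 then 1 else
      -24 * (ArithmeticFunction.sigma 1 m : ℂ)) • qParam 1 τ ^ m) (EisensteinSeries.E2 τ) := by
  simpa only [qParam, Complex.ofReal_one, div_one] using
    EisensteinSeries.hasSum_qExpansion_E2 (z := τ)

lemma cuspFunction_zero_of_hasSum {f : ℍ → ℂ} {c : ℕ → ℂ}
    (hf : AnalyticAt ℂ (cuspFunction 1 f) 0)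
    (h : ∀ τ : ℍ, HasSum (fun m : ℕ ↦ c m • qParam 1 τ ^ m) (f τ)) :
    cuspFunction 1 f 0 = c 0 := by
  have h1 := (hasFPowerSeriesOnBall_cuspFunction one_pos hf h).coeff_zero (fun _ ↦ 0)
  rw [← h1]
  simp [FormalMultilinearSeries.ofScalars]

lemma E2_tendsto_one : Tendsto EisensteinSeries.E2 atImInfty (𝓝 1) := by
  have h := tendsto_cuspFunction_zero periodic_E2 E2_mdifferentiable
    EisensteinSeries.isBoundedAtImInfty_E2
  rwa [cuspFunction_zero_of_hasSum analyticAt_cuspFunction_E2 hasSum_E2,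
    if_pos (Eq.refl 0)] at h

lemma modularForm_tendsto {k : ℤ} (f : ModularForm 𝒮ℒ k) :
    Tendsto f atImInfty (𝓝 ((qExpansion 1 f).coeff 0)) := by
  have := tendsto_cuspFunction_zero
    (by simpa using SlashInvariantFormClass.periodic_comp_ofComplex f one_mem_strictPeriods_SL)
    (ModularFormClass.holo f) (ModularFormClass.bdd_at_infty f)
  simpa [qExpansion_coeff] using this

lemma serreDerivative_tendsto {k : ℤ} (f : ModularForm 𝒮ℒ k) :
    Tendsto (serreDerivative k f) atImInfty
      (𝓝 (-(k / 12 * (qExpansion 1 f).coeff 0))) := by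
  have h1 := normalizedDeriv_tendsto_zero (f := f)
    (by simpa using SlashInvariantFormClass.periodic_comp_ofComplex f one_mem_strictPeriods_SL)
    (ModularFormClass.holo f) (ModularFormClass.bdd_at_infty f)
  have h2 := h1.sub ((E2_tendsto_one.const_mul ((k : ℂ) * 12⁻¹)).mul (modularForm_tendsto f))
  simpa [div_eq_mul_inv] using h2

/-! ### Ramanujan's formulas for `D E4` and `D E6`. -/

/-- The Serre derivative of a level one modular form, as a modular form. -/
def serreForm {k : ℤ} (f : ModularForm 𝒮ℒ k) : ModularForm 𝒮ℒ (k + 2) where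
  toFun := serreDerivative k f
  slash_action_eq' A hA := by
    obtain ⟨A, rfl⟩ := hA
    exact serreDerivative_slash_invariant (ModularFormClass.holo f)
      (SlashInvariantFormClass.slash_action_eq f _ ⟨A, rfl⟩)
  holo' := serreDerivative_mdifferentiable _ (ModularFormClass.holo f)
  bdd_at_cusps' hc := by
    rw [Subgroup.IsArithmetic.isCusp_iff_isCusp_SL2Z] at hc
    rw [OnePoint.isBoundedAt_iff_forall_SL2Z hc]
    -- Level one invariance reduces every cusp to infinity, where the limit is known.
    intro γ _
    have h : serreDerivative k f ∣[k + 2] γ = serreDerivative k f :=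
      serreDerivative_slash_invariant (ModularFormClass.holo f)
      (SlashInvariantFormClass.slash_action_eq f _ ⟨γ, rfl⟩)
    change IsBoundedAtImInfty (serreDerivative k f ∣[k + 2] γ)
    rw [h]
    exact (serreDerivative_tendsto f).isBigO_one ℝ

/-- In a one-dimensional space the constant term determines the form. -/
lemma eq_mul_of_rank_one {k : ℤ} (hk : Module.rank ℂ (ModularForm 𝒮ℒ k) = 1)
    {g f : ModularForm 𝒮ℒ k} {a : ℂ} (hg : Tendsto g atImInfty (𝓝 1))
    (hf : Tendsto f atImInfty (𝓝 a)) : ∀ z, f z = a * g z := by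
  have hg0 : g ≠ 0 := by
    rintro rfl
    exact zero_ne_one (tendsto_nhds_unique (tendsto_const_nhds (x := (0 : ℂ))) hg)
  obtain ⟨c, hc⟩ := (finrank_eq_one_iff_of_nonzero' g hg0).mp
    (Module.rank_eq_one_iff_finrank_eq_one.mp hk) f
  have hfun : (f : ℍ → ℂ) = fun z ↦ c * g z := by
    rw [← hc]; rfl
  have : a = c := by
    rw [hfun] at hf
    exact tendsto_nhds_unique hf (by simpa using hg.const_mul c)
  subst this
  exact fun z ↦ congrFun hfun z

lemma E₄_tendsto_one : Tendsto E₄ atImInfty (𝓝 1) := by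
  simpa [EisensteinSeries.E_qExpansion_coeff_zero _ (show Even 4 from ⟨2, rfl⟩)] using
    modularForm_tendsto E₄

lemma E₆_tendsto_one : Tendsto E₆ atImInfty (𝓝 1) := by
  simpa [EisensteinSeries.E_qExpansion_coeff_zero _ (show Even 6 from ⟨3, rfl⟩)] using
    modularForm_tendsto E₆

theorem serreD_E4 : serreD 4 E4 = (-(1 / 3) : ℂ) • E6 := by
  have h := eq_mul_of_rank_one (k := 6) levelOne_weight_six_rank_one E₆_tendsto_one
    (f := serreForm E₄) (a := -(1 / 3)) (by
      have h := serreDerivative_tendsto E₄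
      rw [EisensteinSeries.E_qExpansion_coeff_zero _ (show Even 4 from ⟨2, rfl⟩)] at h
      rw [show (-(1 / 3) : ℂ) = -(((4 : ℕ) : ℤ) / 12 * 1) by norm_num]
      exact h)
  refine Subtype.ext (funext fun z ↦ ?_)
  refine Eq.trans ?_ (h z)
  change serreDerivative ((4 : ℝ) : ℂ) E₄ z = serreDerivative (((4 : ℕ) : ℤ) : ℂ) E₄ z
  norm_num

theorem serreD_E6 : serreD 6 E6 = (-(1 / 2) : ℂ) • E4 ^ 2 := by
  have h := eq_mul_of_rank_one (k := 8) (by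
      simpa [Nat.ModEq] using dimension_level_one 8 ⟨4, rfl⟩)
    (g := E₄.mul E₄) (by
      have h := E₄_tendsto_one.mul E₄_tendsto_one
      rw [mul_one] at h
      exact h)
    (f := serreForm E₆) (a := -(1 / 2)) (by
      have h := serreDerivative_tendsto E₆
      rw [EisensteinSeries.E_qExpansion_coeff_zero _ (show Even 6 from ⟨3, rfl⟩)] at h
      rw [show (-(1 / 2) : ℂ) = -(((6 : ℕ) : ℤ) / 12 * 1) by norm_num]
      exact h)
  refine Subtype.ext (funext fun z ↦ ?_)
  refine Eq.trans ?_ ((h z).trans ?_)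
  · change serreDerivative ((6 : ℝ) : ℂ) E₆ z = serreDerivative (((6 : ℕ) : ℤ) : ℂ) E₆ z
    norm_num
  · rw [pow_two]; rfl

lemma modularForm_smul {k : ℤ} (f : ModularForm 𝒮ℒ k) (γ : SL(2, ℤ)) (z : ℍ) :
    f (γ • z) = denom γ z ^ k * f z :=
  SlashInvariantForm.slash_action_eqn' f (MonoidHom.mem_range.mpr ⟨γ, rfl⟩) z

lemma E₆_zero : ∃ z : ℍ, E₆ z = 0 := by
  refine ⟨I, ?_⟩
  have h := modularForm_smul E₆ ModularGroup.S I
  have hS : ModularGroup.S • I = I := by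
    rw [modular_S_smul]
    ext
    simp
  rw [hS, ModularGroup.denom_S] at h
  have h6 : (Complex.I : ℂ) ^ 6 = -1 := by
    linear_combination (Complex.I ^ 4 - Complex.I ^ 2 + 1) * Complex.I_sq
  rw [zpow_ofNat, coe_I, h6] at h
  linear_combination h / 2

lemma E₄_zero : ∃ z : ℍ, E₄ z = 0 := by
  have h3 : (Real.sqrt 3 : ℂ) ^ 2 = 3 := by norm_cast; simp
  let ρ : ℍ := ⟨-1 / 2 + Real.sqrt 3 / 2 * Complex.I, by simp⟩
  have hρ : (ρ : ℂ) ^ 2 + ρ + 1 = 0 := by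
    change (-1 / 2 + Real.sqrt 3 / 2 * Complex.I : ℂ) ^ 2 + (-1 / 2 + Real.sqrt 3 / 2 * Complex.I)
      + 1 = 0
    linear_combination (Real.sqrt 3 : ℂ) ^ 2 / 4 * Complex.I_sq - h3 / 4
  have hρ3 : (ρ : ℂ) ^ 3 = 1 := by linear_combination ((ρ : ℂ) - 1) * hρ
  refine ⟨ρ, ?_⟩
  have h0 : (ρ : ℂ) ≠ 0 := ρ.ne_zero
  have h := modularForm_smul E₄ (ModularGroup.S) ρ
  -- `S` and `T` agree at `ρ`, so `E₄ ρ = ρ ^ 4 * E₄ ρ = ρ * E₄ ρ` with `ρ ≠ 1`.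
  have hS : ModularGroup.S • ρ = (1 : ℝ) +ᵥ ρ := by
    rw [modular_S_smul]
    ext
    simp only [coe_vadd, Complex.ofReal_one, inv_neg]
    field_simp
    linear_combination -hρ
  have hT : E₄ ((1 : ℝ) +ᵥ ρ) = E₄ ρ :=
    SlashInvariantForm.vAdd_apply_of_mem_strictPeriods E₄ ρ one_mem_strictPeriods_SL
  rw [hS, hT, ModularGroup.denom_S] at h
  have h4 : (ρ : ℂ) ^ 4 = ρ := by linear_combination (ρ : ℂ) * hρ3
  rw [zpow_ofNat, h4] at h
  have h1 : (ρ : ℂ) ≠ 1 := by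
    intro h1
    rw [h1] at hρ
    norm_num at hρ
  have : ((ρ : ℂ) - 1) * E₄ ρ = 0 := by linear_combination -h
  exact (mul_eq_zero.mp this).resolve_left (sub_ne_zero.mpr h1)

lemma E₄_cube_ne (z : ℍ) : E₄ z ^ 3 ≠ E₆ z ^ 2 := by
  intro h
  apply discriminant_ne_zero z
  rw [discriminant_eq_E₄_cube_sub_E₆_sq, h]
  simp

/-! ### Orders of vanishing and the lower bound. -/

lemma serreD_mul {r a b : ℝ} (h : r = a + b) (F G : Hol) :
    serreD r (F * G) = serreD a F * G + F * serreD b G := by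
  subst h
  refine Subtype.ext ?_
  have := Derivative.serreDerivative_mul a b F.1 G.1 F.2 G.2
  rw [← Complex.ofReal_add] at this
  exact this

lemma serreD_one : serreD 0 1 = 0 := by
  have h := serreD_mul (r := 0) (a := 0) (b := 0) (by simp) 1 1
  simpa using h

lemma serreD_pow {r w : ℝ} {n : ℕ} (h : r = w * n) (A : Hol) :
    serreD r (A ^ n) = n * A ^ (n - 1) * serreD w A := by
  subst h
  induction n with
  | zero => simpa using serreD_one
  | succ n ih =>
    rw [pow_succ, serreD_mul (a := w * n) (b := w) (by push_cast; ring), ih]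
    cases n with
    | zero => simp
    | succ n => simp; ring

instance : NoZeroDivisors Hol where
  eq_zero_or_eq_zero_of_mul_eq_zero {F G} h := by
    have h' : F.1 * G.1 = 0 := congrArg Subtype.val h
    exact ((UpperHalfPlane.mul_eq_zero_iff F.2 G.2).mp h').imp (fun h ↦ Subtype.ext h)
      fun h ↦ Subtype.ext h

/-- Iterating the Serre derivative lowers the order of vanishing at a simple zero by exactly one
at each step. -/
lemma serreIter_pow_mul {A u : Hol} {z : ℍ} {w : ℝ} (hA : A.1 z = 0) (hB : (serreD w A).1 z ≠ 0)
    (hu : u.1 z ≠ 0) (k : ℝ) {m i : ℕ} (hi : i ≤ m) :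
    ∃ v : Hol, serreIter k i (A ^ m * u) = A ^ (m - i) * v ∧ v.1 z ≠ 0 := by
  induction i with
  | zero => exact ⟨u, rfl, hu⟩
  | succ i ih =>
    obtain ⟨v, hv, hvz⟩ := ih (by lia)
    obtain ⟨j, hj⟩ : ∃ j, m - i = j + 1 := ⟨m - i - 1, by lia⟩
    -- Leibniz on `A ^ (j + 1) * v`, with `A ^ j` taken out; at `z` only the first summand survives.
    refine ⟨(j + 1 : ℕ) * serreD w A * v + A * serreD (k + 2 * i - w * (j + 1 : ℕ)) v, ?_, ?_⟩
    · rw [serreIter, LinearMap.comp_apply, hv, hj,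
        serreD_mul (a := w * (j + 1 : ℕ)) (b := k + 2 * i - w * (j + 1 : ℕ)) (by ring),
        serreD_pow rfl, show m - (i + 1) = j by lia, Nat.add_sub_cancel]
      ring
    · have h : ((j + 1 : ℕ) * serreD w A * v + A * serreD (k + 2 * i - w * (j + 1 : ℕ)) v : Hol).1 z
          = (j + 1 : ℕ) * (serreD w A).1 z * v.1 z
            + A.1 z * (serreD (k + 2 * i - w * (j + 1 : ℕ)) v).1 z := rfl
      rw [h, hA, zero_mul, add_zero]
      exact mul_ne_zero (mul_ne_zero (Nat.cast_ne_zero.mpr (Nat.succ_ne_zero j)) hB) hvz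

/-- A solution of a monic equation of order `N` does not vanish to order `N` or more. -/
lemma lt_of_monic_equation {A u : Hol} {z : ℍ} {w : ℝ} (hA : A.1 z = 0)
    (hB : (serreD w A).1 z ≠ 0) (hu : u.1 z ≠ 0) {k : ℝ} {m N : ℕ} {ι : Type*} [Fintype ι]
    (c : ι → Hol) {d : ι → ℕ} (hd : ∀ i, d i < N)
    (h : serreIter k N (A ^ m * u) + ∑ i, c i * serreIter k (d i) (A ^ m * u) = 0) : m < N := by
  by_contra! hN
  have hA0 : A ≠ 0 := by
    rintro rfl
    exact hB (by simp)
  choose v hv hvz using fun i : ℕ ↦ fun hi : i ≤ m ↦ serreIter_pow_mul hA hB hu k hi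
  have hle (i : ι) : d i ≤ m := (hd i).le.trans hN
  -- Each term of order below `N` carries at least one more factor `A`.
  have hsum : A ^ (m - N) * (v N hN + A * ∑ i, c i * (A ^ (N - d i - 1) * v (d i) (hle i))) = 0 := by
    rw [← h, hv N hN, mul_add, Finset.mul_sum, Finset.mul_sum]
    congr 1
    refine Finset.sum_congr rfl fun i _ ↦ ?_
    have := hd i
    rw [hv _ (hle i), show m - d i = (m - N) + (N - d i - 1) + 1 by lia]
    ring
  have h0 := (mul_eq_zero.mp hsum).resolve_left (pow_ne_zero _ hA0)
  have hz : (v N hN).1 z + A.1 z * (∑ i, c i * (A ^ (N - d i - 1) * v (d i) (hle i))).1 z = 0 :=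
    congrFun (congrArg Subtype.val h0) z
  rw [hA, zero_mul, add_zero] at hz
  exact hvz N hN hz

lemma max_lt_of_monic_equation {k : ℝ} {m n N : ℕ} {ι : Type*} [Fintype ι]
    (c : ι → Hol) {d : ι → ℕ} (hd : ∀ i, d i < N)
    (h : serreIter k N (E4 ^ m * E6 ^ n) + ∑ i, c i * serreIter k (d i) (E4 ^ m * E6 ^ n) = 0) :
    max m n < N := by
  refine max_lt ?_ ?_
  · obtain ⟨z, hz⟩ := E₄_zero
    have h6 : ModularForm.E₆ z ≠ 0 := fun h6 ↦ E₄_cube_ne z (by rw [hz, h6]; norm_num)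
    refine lt_of_monic_equation (w := 4) (z := z) hz ?_ ?_ c hd h
    · rw [serreD_E4]
      exact mul_ne_zero (by norm_num) h6
    · exact pow_ne_zero n h6
  · obtain ⟨z, hz⟩ := E₆_zero
    have h4 : ModularForm.E₄ z ≠ 0 := fun h4 ↦ E₄_cube_ne z (by rw [hz, h4]; norm_num)
    rw [mul_comm] at h
    refine lt_of_monic_equation (w := 6) (z := z) hz ?_ ?_ c hd h
    · rw [serreD_E6]
      exact mul_ne_zero (by norm_num) (pow_ne_zero 2 h4)
    · exact pow_ne_zero m h4

lemma MLDE.IsMonic.max_lt {k : ℝ} {m n N : ℕ} {e : MLDE k N} (he : e.IsMonic)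
    (hs : e.IsSolution (E4 ^ m * E6 ^ n)) : max m n < N := by
  rw [MLDE.IsSolution, Fin.sum_univ_succ,
    show formToHol (e.coeff 0) = 1 from Subtype.ext (funext he.2), one_mul] at hs
  exact max_lt_of_monic_equation (fun i : Fin N ↦ formToHol (e.coeff i.succ))
    (d := fun i ↦ N - (i.succ : ℕ)) (fun i ↦ by have := i.2; simp; lia) hs

/-! ### From operators on `H` to equations in `Hol`. -/

/-- The sum of the components of an element of `H`. -/
def total : H →ₗ[ℂ] Hol := DirectSum.toModule ℂ ℝ Hol fun _ ↦ LinearMap.id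

lemma total_inWeight (r : ℝ) (f : Hol) : total (inWeight r f) = f := by
  simp [total, inWeight]

lemma delta_inWeight (r : ℝ) (f : Hol) : delta (inWeight r f) = inWeight (r + 2) (serreD r f) := by
  simp [delta, inWeight]

lemma e4_inWeight (r : ℝ) (f : Hol) : e4 (inWeight r f) = inWeight (r + 4) (E4 * f) := by
  simp [e4, inWeight]

lemma e6_inWeight (r : ℝ) (f : Hol) : e6 (inWeight r f) = inWeight (r + 6) (E6 * f) := by
  simp [e6, inWeight]

lemma H_hom_ext {M : Type*} [AddCommMonoid M] [Module ℂ M] {a b : H →ₗ[ℂ] M}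
    (h : ∀ r f, a (inWeight r f) = b (inWeight r f)) : a = b :=
  DirectSum.linearMap_ext ℂ fun r ↦ LinearMap.ext fun f ↦ h r f

lemma delta_pow_inWeight (r : ℝ) (f : Hol) (i : ℕ) :
    (delta ^ i) (inWeight r f) = inWeight (r + 2 * i) (serreIter r i f) := by
  induction i with
  | zero => simp [serreIter]
  | succ i ih =>
    rw [pow_succ', Module.End.mul_apply, ih, delta_inWeight, serreIter, LinearMap.comp_apply,
      show r + 2 * i + 2 = r + 2 * ((i + 1 : ℕ) : ℝ) by push_cast; ring]

lemma total_e4 (x : H) : total (e4 x) = E4 * total x := by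
  have : total ∘ₗ e4 = LinearMap.mulLeft ℂ E4 ∘ₗ total :=
    H_hom_ext fun r f ↦ by simp [e4_inWeight, total_inWeight]
  exact LinearMap.congr_fun this x

lemma total_e6 (x : H) : total (e6 x) = E6 * total x := by
  have : total ∘ₗ e6 = LinearMap.mulLeft ℂ E6 ∘ₗ total :=
    H_hom_ext fun r f ↦ by simp [e6_inWeight, total_inWeight]
  exact LinearMap.congr_fun this x

/-- Forgetting the grading turns even mixed-weight coefficients into multiplications. `delta` has no
such description, as `serreD r` depends on `r`; its powers are evaluated on `inWeight r f`
beforehand. -/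
lemma exists_total_eq_mul {c : Module.End ℂ H} (hc : c ∈ MLDOCoeff) :
    ∃ g : Hol, ∀ x, total (c x) = g * total x := by
  induction hc using Algebra.adjoin_induction with
  | mem x hx =>
    rcases hx with rfl | rfl
    exacts [⟨E4, total_e4⟩, ⟨E6, total_e6⟩]
  | algebraMap a => exact ⟨algebraMap ℂ Hol a, fun x ↦ by
      rw [Module.algebraMap_end_apply, map_smul, Algebra.smul_def]⟩
  | add x y _ _ hx hy =>
    obtain ⟨g, hg⟩ := hx
    obtain ⟨g', hg'⟩ := hy
    exact ⟨g + g', fun x ↦ by rw [LinearMap.add_apply, map_add, hg, hg', add_mul]⟩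
  | mul x y _ _ hx hy =>
    obtain ⟨g, hg⟩ := hx
    obtain ⟨g', hg'⟩ := hy
    exact ⟨g * g', fun x ↦ by rw [Module.End.mul_apply, hg, hg', mul_assoc]⟩

lemma max_lt_of_monicMLDO {r : ℝ} {m n N : ℕ} {a : Module.End ℂ H} (ha : a ∈ monicMLDO N)
    (h : a (inWeight r (E4 ^ m * E6 ^ n)) = 0) : max m n < N := by
  obtain ⟨-, c, rfl⟩ := ha
  choose g hg using fun i ↦ exists_total_eq_mul (c i).2
  refine max_lt_of_monic_equation (k := r) g (d := fun i : Fin N ↦ i) (fun i ↦ i.2) ?_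
  have := congrArg total h
  simpa [LinearMap.sum_apply, hg, delta_pow_inWeight, total_inWeight] using this

theorem le_mord (r : ℝ) (m n : ℕ) :
    ((max m n + 1 : ℕ) : ℕ∞) ≤ mord (inWeight r (E4 ^ m * E6 ^ n)) := by
  refine le_sInf ?_
  rintro _ ⟨N, rfl, a, ha, h⟩
  exact_mod_cast max_lt_of_monicMLDO ha h

/-! ### Commutation rules and normal form of operators. -/

lemma delta_mul_e4 : delta * e4 = e4 * delta + (-(1 / 3) : ℂ) • e6 := by
  refine H_hom_ext fun r f ↦ ?_
  simp only [Module.End.mul_apply, LinearMap.add_apply, LinearMap.smul_apply, e4_inWeight,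
    e6_inWeight, delta_inWeight]
  rw [serreD_mul (a := 4) (b := r) (by ring), serreD_E4, show r + 4 + 2 = r + 6 by ring,
    show r + 2 + 4 = r + 6 by ring, ← map_smul, ← map_add, smul_mul_assoc,
    add_comm (_ • _)]

lemma delta_mul_e6 : delta * e6 = e6 * delta + (-(1 / 2) : ℂ) • (e4 * e4) := by
  refine H_hom_ext fun r f ↦ ?_
  simp only [Module.End.mul_apply, LinearMap.add_apply, LinearMap.smul_apply, e4_inWeight,
    e6_inWeight, delta_inWeight]
  rw [serreD_mul (a := 6) (b := r) (by ring), serreD_E6, show r + 6 + 2 = r + 8 by ring,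
    show r + 2 + 6 = r + 8 by ring, show r + 4 + 4 = r + 8 by ring, ← map_smul, ← map_add,
    smul_mul_assoc, add_comm (_ • _), pow_two, mul_assoc]

lemma e4_mem : e4 ∈ MLDOCoeff := Algebra.subset_adjoin (by simp)

lemma e6_mem : e6 ∈ MLDOCoeff := Algebra.subset_adjoin (by simp)

/-- The commutator with `delta` is a derivation, and it sends both generators into `MLDOCoeff`. -/
lemma exists_delta_mul {c : Module.End ℂ H} (hc : c ∈ MLDOCoeff) :
    ∃ d ∈ MLDOCoeff, delta * c = c * delta + d := by
  induction hc using Algebra.adjoin_induction with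
  | mem x hx =>
    rcases hx with rfl | rfl
    · exact ⟨_, Subalgebra.smul_mem _ e6_mem _, delta_mul_e4⟩
    · exact ⟨_, Subalgebra.smul_mem _ (mul_mem e4_mem e4_mem) _, delta_mul_e6⟩
  | algebraMap a => exact ⟨0, zero_mem _, by rw [add_zero, Algebra.commutes]⟩
  | add x y _ _ hx hy =>
    obtain ⟨d, hd, h⟩ := hx
    obtain ⟨d', hd', h'⟩ := hy
    exact ⟨d + d', add_mem hd hd', by rw [mul_add, add_mul, h, h', add_add_add_comm]⟩
  | mul x y hx' hy' hx hy =>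
    obtain ⟨d, hd, h⟩ := hx
    obtain ⟨d', hd', h'⟩ := hy
    exact ⟨x * d' + d * y, add_mem (mul_mem hx' hd') (mul_mem hd hy'), by
      rw [← mul_assoc, h, add_mul, mul_assoc, h', mul_add, ← mul_assoc, add_assoc]⟩

/-- The operators of order less than `N`. -/
def orderLT (N : ℕ) : Submodule MLDOCoeff (Module.End ℂ H) :=
  Submodule.span MLDOCoeff (Set.range fun i : Fin N ↦ delta ^ (i : ℕ))

lemma delta_pow_mem_orderLT {i N : ℕ} (h : i < N) : delta ^ i ∈ orderLT N :=
  Submodule.subset_span ⟨⟨i, h⟩, rfl⟩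

lemma orderLT_mono {M N : ℕ} (h : M ≤ N) : orderLT M ≤ orderLT N :=
  Submodule.span_le.mpr (by
    rintro _ ⟨i, rfl⟩
    exact delta_pow_mem_orderLT (i.2.trans_le h))

lemma mul_mem_orderLT {c a : Module.End ℂ H} {N : ℕ} (hc : c ∈ MLDOCoeff) (ha : a ∈ orderLT N) :
    c * a ∈ orderLT N :=
  (orderLT N).smul_mem ⟨c, hc⟩ ha

lemma delta_mul_mem_orderLT {a : Module.End ℂ H} {N : ℕ} (ha : a ∈ orderLT N) :
    delta * a ∈ orderLT (N + 1) := by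
  induction ha using Submodule.span_induction with
  | mem x hx =>
    obtain ⟨i, rfl⟩ := hx
    simp only [← pow_succ']
    exact delta_pow_mem_orderLT (Nat.succ_lt_succ i.2)
  | zero => simp
  | add x y _ _ hx hy => simpa [mul_add] using add_mem hx hy
  | smul c x hx' hx =>
    obtain ⟨d, hd, h⟩ := exists_delta_mul c.2
    have h' : delta * (c • x) = c * (delta * x) + d * x := by
      rw [Subalgebra.smul_def, smul_eq_mul, ← mul_assoc, h, add_mul, mul_assoc]
    rw [h']
    exact add_mem (mul_mem_orderLT c.2 hx) (mul_mem_orderLT hd (orderLT_mono N.le_succ hx'))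

lemma mem_monicMLDO {a : Module.End ℂ H} {N : ℕ} (ha : ∃ b ∈ orderLT N, a = delta ^ N + b) :
    a ∈ monicMLDO N := by
  obtain ⟨b, hb, rfl⟩ := ha
  obtain ⟨c, rfl⟩ := (Submodule.mem_span_range_iff_exists_fun _).mp hb
  have h : delta ^ N + ∑ i : Fin N, c i • delta ^ (i : ℕ) =
      delta ^ N + ∑ i : Fin N, (c i : Module.End ℂ H) * delta ^ (i : ℕ) := rfl
  refine ⟨?_, c, h⟩
  have hd : delta ∈ MLDO := Algebra.subset_adjoin (by simp)
  have hle : MLDOCoeff ≤ MLDO := Algebra.adjoin_mono (by simp)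
  rw [h]
  exact add_mem (pow_mem hd N) (sum_mem fun i _ ↦ mul_mem (hle (c i).2) (pow_mem hd _))

/-! ### Symmetric powers and the upper bound. -/

lemma serreD_pow_mul_pow {w : ℝ} {y : Hol} {c : ℂ}
    (hy : serreD (w + 2) (serreD w y) = c • (E4 * y)) (j k : ℕ) :
    serreD (w * (k + 1 + j : ℕ) + 2 * (k + 1)) (y ^ j * serreD w y ^ (k + 1)) =
      j * y ^ (j - 1) * serreD w y ^ (k + 2) +
        ((k + 1 : ℕ) : ℂ) • c • (E4 * y ^ (j + 1) * serreD w y ^ k) := by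
  rw [serreD_mul (a := w * j) (b := (w + 2) * (k + 1 : ℕ)) (by push_cast; ring),
    serreD_pow rfl, serreD_pow rfl, hy, Nat.add_sub_cancel]
  simp only [Algebra.smul_def, map_natCast]
  ring

lemma descFactorial_succ_eq (j k : ℕ) :
    (k + 1 + j).descFactorial (k + 1) = (j + 1) * (k + 1 + j).descFactorial k ∧
      (k + 1 + j).descFactorial (k + 1 + 1) =
        j * ((j + 1) * (k + 1 + j).descFactorial k) := by
  rw [Nat.descFactorial_succ _ (k + 1), Nat.descFactorial_succ _ k,
    show k + 1 + j - (k + 1) = j by omega, show k + 1 + j - k = j + 1 by omega]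
  exact ⟨rfl, rfl⟩

/-- The `A`-terms cancel because `(k + 1 + j).descFactorial (k + 1)` is `j + 1` times `(k + 1 +
j).descFactorial k`. At `j = 0` the truncated exponent `j - 1` is harmless: its coefficient
vanishes. -/
lemma symmetricPower_identity {R : Type*} [CommRing R] [Algebra ℂ R] (c : ℂ) (A y x : R) (j k : ℕ) :
    ((k + 1 + j).descFactorial (k + 1) : R) * (j * y ^ (j - 1) * x ^ (k + 2) +
        ((k + 1 : ℕ) : ℂ) • c • (A * y ^ (j + 1) * x ^ k)) +
      (-(((k + 1) * (j + 1) : ℂ) * c)) •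
        (A * (((k + 1 + j).descFactorial k : R) * (y ^ (j + 1) * x ^ k))) =
      ((k + 1 + j).descFactorial (k + 1 + 1) : R) * (y ^ (j - 1) * x ^ (k + 1 + 1)) := by
  rw [(descFactorial_succ_eq j k).1, (descFactorial_succ_eq j k).2]
  simp only [Algebra.smul_def, map_natCast, map_neg, map_mul, map_add, map_one]
  push_cast
  ring

/-- The operators `L₀ = 1`, `L₁ = δ`, `L_{k+1} = δ L_k - k (n - k + 1) c e₄ L_{k-1}` of the `n`-th
symmetric power of the equation `y'' = c E₄ y`. -/
lemma exists_symmetricPower {w : ℝ} {y : Hol} {c : ℂ}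
    (hy : serreD (w + 2) (serreD w y) = c • (E4 * y)) (n k : ℕ) (hk : k ≤ n) :
    ∃ L M : Module.End ℂ H, (∃ b ∈ orderLT k, L = delta ^ k + b) ∧
      (∃ b ∈ orderLT (k + 1), M = delta ^ (k + 1) + b) ∧
      L (inWeight (w * n) (y ^ n)) = inWeight (w * n + 2 * k)
        ((n.descFactorial k : Hol) * (y ^ (n - k) * serreD w y ^ k)) ∧
      M (inWeight (w * n) (y ^ n)) = inWeight (w * n + 2 * (k + 1))
        ((n.descFactorial (k + 1) : Hol) * (y ^ (n - (k + 1)) * serreD w y ^ (k + 1))) := by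
  -- The recurrence has three terms, so the induction carries the consecutive pair `L_k`, `L_{k+1}`.
  induction k with
  | zero =>
    refine ⟨1, delta, ⟨0, zero_mem _, by simp⟩, ⟨0, zero_mem _, by simp⟩, by simp, ?_⟩
    rw [delta_inWeight, serreD_pow rfl]
    simp [mul_assoc]
  | succ k ih =>
    obtain ⟨L, M, hL, hM, hLy, hMy⟩ := ih (by lia)
    obtain ⟨j, rfl⟩ : ∃ j, n = k + 1 + j := ⟨n - (k + 1), by lia⟩
    refine ⟨M, delta * M + (-(((k + 1) * (j + 1) : ℂ) * c) • e4) * L, hM, ?_, by simpa using hMy,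
      ?_⟩
    · obtain ⟨b, hb, rfl⟩ := hL
      obtain ⟨b', hb', rfl⟩ := hM
      exact ⟨_, add_mem (delta_mul_mem_orderLT hb')
        (mul_mem_orderLT (Subalgebra.smul_mem _ e4_mem _) (add_mem (delta_pow_mem_orderLT
          (show k < k + 1 + 1 by lia)) (orderLT_mono (by lia) hb))), by
        rw [mul_add, ← pow_succ', add_assoc]⟩
    · rw [LinearMap.add_apply, Module.End.mul_apply, Module.End.mul_apply, LinearMap.smul_apply,
        hLy, hMy, delta_inWeight, e4_inWeight, ← nsmul_eq_mul, map_nsmul, nsmul_eq_mul,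
        show k + 1 + j - (k + 1) = j by lia, show k + 1 + j - k = j + 1 by lia,
        show k + 1 + j - (k + 1 + 1) = j - 1 by lia, serreD_pow_mul_pow hy, ← map_smul,
        show w * (k + 1 + j : ℕ) + 2 * (k : ℝ) + 4 =
          w * (k + 1 + j : ℕ) + 2 * ((k + 1 : ℕ) + 1) by push_cast; ring,
        show w * (k + 1 + j : ℕ) + 2 * ((k : ℝ) + 1) + 2 =
          w * (k + 1 + j : ℕ) + 2 * ((k + 1 : ℕ) + 1) by push_cast; ring, ← map_add]
      exact congrArg _ (symmetricPower_identity c E4 y (serreD w y) j k)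

theorem mord_pow_le {w : ℝ} {y : Hol} {c : ℂ}
    (hy : serreD (w + 2) (serreD w y) = c • (E4 * y)) (n : ℕ) :
    mord (inWeight (w * n) (y ^ n)) ≤ ((n + 1 : ℕ) : ℕ∞) := by
  obtain ⟨-, M, -, hM, -, hMy⟩ := exists_symmetricPower hy n n le_rfl
  refine sInf_le ⟨n + 1, rfl, M, mem_monicMLDO hM, ?_⟩
  -- `L_{n+1}` kills `y ^ n` because the falling factorial of `n` of length `n + 1` contains the
  -- factor `0`.
  rw [hMy, Nat.descFactorial_of_lt n.lt_succ_self]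
  simp

lemma serreD_serreD_E4 : serreD (4 + 2) (serreD 4 E4) = (1 / 6 : ℂ) • (E4 * E4) := by
  rw [serreD_E4, map_smul, show (4 + 2 : ℝ) = 6 by norm_num, serreD_E6, smul_smul, pow_two]
  norm_num

lemma serreD_E4_sq : serreD 8 (E4 ^ 2) = (-(2 / 3) : ℂ) • (E4 * E6) := by
  rw [pow_two, serreD_mul (a := 4) (b := 4) (by norm_num), serreD_E4, smul_mul_assoc,
    mul_smul_comm, mul_comm E6, ← add_smul]
  norm_num

lemma serreD_serreD_E6 : serreD (6 + 2) (serreD 6 E6) = (1 / 3 : ℂ) • (E4 * E6) := by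
  rw [serreD_E6, map_smul, show (6 + 2 : ℝ) = 8 by norm_num, serreD_E4_sq, smul_smul]
  norm_num

lemma serreD_serreD_E4_mul_E6 :
    serreD (10 + 2) (serreD 10 (E4 * E6)) = (5 / 6 : ℂ) • (E4 * (E4 * E6)) := by
  rw [serreD_mul (a := 4) (b := 6) (by norm_num), map_add,
    serreD_mul (r := 10 + 2) (a := 6) (b := 6) (by norm_num),
    serreD_mul (r := 10 + 2) (a := 4) (b := 8) (by norm_num), serreD_E4, serreD_E6, map_smul,
    map_smul, serreD_E4_sq, serreD_E6]
  simp only [mul_smul_comm, smul_smul, pow_two, mul_comm, mul_left_comm]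
  match_scalars
  norm_num

end

end ModularLDE

open ModularLDE in
theorem mainTheorem1 :
    (∀ m n N : ℕ, 0 < N →
      (∃ e : MLDE (4 * m + 6 * n : ℝ) N, e.IsMonic ∧ e.IsSolution (E4 ^ m * E6 ^ n)) →
      max m n + 1 ≤ N) ∧
    (∀ m n : ℕ,
      ((max m n + 1 : ℕ) : ℕ∞) ≤ mord (inWeight (4 * m + 6 * n : ℝ) (E4 ^ m * E6 ^ n))) ∧
    (∀ n : ℕ,
      mord (inWeight (4 * n : ℝ) (E4 ^ n)) = ((n + 1 : ℕ) : ℕ∞) ∧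
      mord (inWeight (6 * n : ℝ) (E6 ^ n)) = ((n + 1 : ℕ) : ℕ∞) ∧
      mord (inWeight (10 * n : ℝ) (E4 ^ n * E6 ^ n)) = ((n + 1 : ℕ) : ℕ∞)) := by
  refine ⟨fun m n N _ ⟨e, he, hs⟩ ↦ he.max_lt hs, fun m n ↦ le_mord _ m n, fun n ↦
    ⟨le_antisymm (mord_pow_le serreD_serreD_E4 n) ?_,
      le_antisymm (mord_pow_le serreD_serreD_E6 n) ?_, le_antisymm ?_ ?_⟩⟩
  · simpa using le_mord (4 * n) n 0
  · simpa using le_mord (6 * n) 0 n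
  · rw [← mul_pow]
    exact mord_pow_le serreD_serreD_E4_mul_E6 n
  · simpa using le_mord (10 * n) n n
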